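/- **Duality theorem.** Let $d \ge 1$. Let $BV([0,1]^d)$ be the space of (classes of) Lebesgue integrable functions $u \colon \mathbb{R}^d \to \mathbb{R}$ that vanish almost everywhere outside $[0,1]^d$ and whose variation $$\|Du\|(\mathbb{R}^d) = \sup\left\{ \int_{\mathbb{R}^d} u \,\operatorname{div} v : v \in C^1_c(\mathbb{R}^d;\mathbb{R}^d),\ |v(x)| \le 1 \text{ for all } x \right\}$$ is finite, equipped with the norm $\|u\|_{BV} = \|u\|_{L^1} + \|Du\|(\mathbb{R}^d)$. For $f \in L^d([0,1]^d)$ let $T_f(u) = \int_{[0,1]^d} f u$ for $u \in BV([0,1]^d)$. Then these integrals converge absolutely, $T_f \in BV([0,1]^d)^*$, and there is a constant $C$ such that $\|T_f\| \le C \|f\|_{L^d}$ for all $f \in L^d([0,1]^d)$. Let $SCH([0,1]^d)$ be the closure of $\{T_f : f \in L^d([0,1]^d)\}$ in $BV([0,1]^d)^*$ for the dual norm. Then $BV([0,1]^d)$ and $SCH([0,1]^d)$ are Banach spaces and the canonical map $$\Upsilon \colon BV([0,1]^d) \to SCH([0,1]^d)^*, \qquad \Upsilon(u)(\alpha) = \alpha(u),$$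 is an isomorphism of Banach spaces, that is, a linear bijection that is continuous together with its inverse. In particular, $SCH([0,1]^d)$ is a predual of $BV([0,1]^d)$. -/

import Mathlib

set_option maxSynthPendingDepth 3

open MeasureTheory
open scoped ENNReal

noncomputable section

namespace StrongCharge

/-- The ambient space `ℝ^d` with its Euclidean norm and Lebesgue measure. -/
abbrev E (d : ℕ) : Type := EuclideanSpace ℝ (Fin d)

/-- The closed unit cube `[0,1]^d`. -/
def cube (d : ℕ) : Set (E d) := {x | ∀ i, x i ∈ Set.Icc (0 : ℝ) 1}

/-- The divergence `∑ i, ∂ᵢ vᵢ` of a vector field. -/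
def divergence {d : ℕ} (v : E d → E d) (x : E d) : ℝ :=
  ∑ i, (fderiv ℝ v x (EuclideanSpace.single i 1)) i

/-- Admissible test fields: `C¹`, compactly supported, of pointwise Euclidean norm at most one. -/
structure IsTestField {d : ℕ} (v : E d → E d) : Prop where
  contDiff : ContDiff ℝ 1 v
  hasCompactSupport : HasCompactSupport v
  norm_le_one : ∀ x, ‖v x‖ ≤ 1

/-- The variation `‖Du‖(ℝ^d) = sup {∫ u div v}` of an integrable function `u` on `ℝ^d`, the
supremum being over all admissible test fields. (As `v = 0` is admissible, truncating the
integrals at `0` does not change the supremum.) -/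
def variation {d : ℕ} (u : E d → ℝ) : ℝ≥0∞ :=
  ⨆ (v : E d → E d) (_ : IsTestField v), ENNReal.ofReal (∫ x, u x * divergence v x)

theorem IsTestField.neg {d : ℕ} {v : E d → E d} (hv : IsTestField v) : IsTestField (-v) :=
  ⟨hv.contDiff.neg, hv.hasCompactSupport.neg, fun x => by simpa using hv.norm_le_one x⟩

theorem divergence_neg {d : ℕ} (v : E d → E d) (x : E d) :
    divergence (-v) x = -divergence v x := by
  simp [divergence, fderiv_neg]

theorem IsTestField.integrable_mul {d : ℕ} {v : E d → E d} (hv : IsTestField v) {u : E d → ℝ}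
    (hu : Integrable u) : Integrable (fun x => u x * divergence v x) := by
  have hc : Continuous (divergence v) := by
    have h := hv.contDiff.continuous_fderiv one_ne_zero
    unfold divergence
    fun_prop
  have hs : HasCompactSupport (divergence v) := by
    refine (hv.hasCompactSupport.fderiv (𝕜 := ℝ)).mono' ?_
    intro x hx
    refine subset_tsupport _ ?_
    intro h0
    exact hx (by simp [divergence, h0])
  obtain ⟨C, hC⟩ := hs.exists_bound_of_continuous hc
  exact hu.mul_bdd hc.aestronglyMeasurable (Filter.Eventually.of_forall hC)

theorem variation_congr {d : ℕ} {u w : E d → ℝ} (h : u =ᵐ[volume] w) :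
    variation u = variation w := by
  unfold variation
  refine iSup_congr fun v => iSup_congr fun _ => ?_
  congr 1
  exact integral_congr_ae (h.mono fun x hx => by simp [hx])

theorem variation_zero {d : ℕ} : variation (0 : E d → ℝ) = 0 := by
  simp [variation]

theorem variation_add_le {d : ℕ} {u w : E d → ℝ} (hu : Integrable u) (hw : Integrable w) :
    variation (u + w) ≤ variation u + variation w := by
  refine iSup₂_le fun v hv => ?_
  have h : ∫ x, (u + w) x * divergence v x
      = (∫ x, u x * divergence v x) + ∫ x, w x * divergence v x := by
    rw [← integral_add (hv.integrable_mul hu) (hv.integrable_mul hw)]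
    simp [add_mul]
  rw [h]
  exact ENNReal.ofReal_add_le.trans
    (add_le_add (le_iSup₂_of_le v hv le_rfl) (le_iSup₂_of_le v hv le_rfl))

theorem variation_smul_le {d : ℕ} (c : ℝ) (u : E d → ℝ) :
    variation (c • u) ≤ ENNReal.ofReal |c| * variation u := by
  refine iSup₂_le fun v hv => ?_
  have h : ∫ x, (c • u) x * divergence v x = c * ∫ x, u x * divergence v x := by
    rw [← integral_const_mul]
    simp [mul_assoc]
  rw [h]
  rcases le_total 0 c with hc | hc
  · rw [ENNReal.ofReal_mul hc, abs_of_nonneg hc]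
    gcongr
    exact le_iSup₂_of_le v hv le_rfl
  · have h2 : c * ∫ x, u x * divergence v x = (-c) * ∫ x, u x * divergence (-v) x := by
      simp [divergence_neg, integral_neg]
    rw [h2, ENNReal.ofReal_mul (by linarith), abs_of_nonpos hc]
    gcongr
    exact le_iSup₂_of_le (-v) hv.neg le_rfl

/-- The underlying vector space of `BV([0,1]^d)`: classes of integrable functions on `ℝ^d` that
vanish almost everywhere outside `[0,1]^d` and have finite variation over `ℝ^d`. -/
def bvSubmodule (d : ℕ) : Submodule ℝ (Lp ℝ 1 (volume : Measure (E d))) where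
  carrier := {u | (∀ᵐ x, x ∉ cube d → u x = 0) ∧ variation u < ∞}
  zero_mem' := by
    refine ⟨?_, ?_⟩
    · filter_upwards [Lp.coeFn_zero ℝ 1 (volume : Measure (E d))] with x hx _
      rw [hx]; rfl
    · rw [variation_congr (Lp.coeFn_zero ℝ 1 (volume : Measure (E d))), variation_zero]
      exact ENNReal.zero_lt_top
  add_mem' := by
    rintro u w ⟨hu, hu'⟩ ⟨hw, hw'⟩
    refine ⟨?_, ?_⟩
    · filter_upwards [Lp.coeFn_add u w, hu, hw] with x hx h1 h2 hxc
      rw [hx, Pi.add_apply, h1 hxc, h2 hxc, add_zero]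
    · rw [variation_congr (Lp.coeFn_add u w)]
      exact (variation_add_le (L1.integrable_coeFn u) (L1.integrable_coeFn w)).trans_lt
        (ENNReal.add_lt_top.2 ⟨hu', hw'⟩)
  smul_mem' := by
    rintro c u ⟨hu, hu'⟩
    refine ⟨?_, ?_⟩
    · filter_upwards [Lp.coeFn_smul c u, hu] with x hx h1 hxc
      rw [hx, Pi.smul_apply, h1 hxc, smul_zero]
    · rw [variation_congr (Lp.coeFn_smul c u)]
      exact (variation_smul_le c u).trans_lt (ENNReal.mul_lt_top ENNReal.ofReal_lt_top hu')

/-- The space `BV([0,1]^d)`; its norm is defined below (it is not the one inherited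
from `L¹`). -/
def BV (d : ℕ) : Type := bvSubmodule d

namespace BV

variable {d : ℕ}

instance : AddCommGroup (BV d) := inferInstanceAs (AddCommGroup (bvSubmodule d))

instance : Module ℝ (BV d) := inferInstanceAs (Module ℝ (bvSubmodule d))

/-- The inclusion of `BV([0,1]^d)` in `L¹(ℝ^d)`. -/
def toL1 : BV d →ₗ[ℝ] Lp ℝ 1 (volume : Measure (E d)) := (bvSubmodule d).subtype

instance : CoeFun (BV d) (fun _ => E d → ℝ) := ⟨fun u => (toL1 u : E d → ℝ)⟩

theorem variation_lt_top (u : BV d) : variation (u : E d → ℝ) < ∞ := u.2.2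

/-- `u ↦ ‖Du‖(ℝ^d)` as a seminorm on `BV([0,1]^d)`. -/
def variationSeminorm (d : ℕ) : Seminorm ℝ (BV d) :=
  Seminorm.ofSMulLE (fun u => (variation (u : E d → ℝ)).toReal)
    (by
      have h : variation ((0 : BV d) : E d → ℝ) = 0 := by
        rw [map_zero, variation_congr (Lp.coeFn_zero ℝ 1 (volume : Measure (E d))), variation_zero]
      simp only [h, ENNReal.toReal_zero])
    (fun u w => by
      rw [← ENNReal.toReal_add u.variation_lt_top.ne w.variation_lt_top.ne]
      refine ENNReal.toReal_mono
        (ENNReal.add_ne_top.2 ⟨u.variation_lt_top.ne, w.variation_lt_top.ne⟩) ?_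
      rw [map_add, variation_congr (Lp.coeFn_add _ _)]
      exact variation_add_le (L1.integrable_coeFn _) (L1.integrable_coeFn _))
    (fun c u => by
      have h : variation ((c • u : BV d) : E d → ℝ) ≤ ENNReal.ofReal |c| * variation u := by
        rw [map_smul, variation_congr (Lp.coeFn_smul _ _)]
        exact variation_smul_le c _
      have h2 := ENNReal.toReal_mono
        (ENNReal.mul_ne_top ENNReal.ofReal_ne_top u.variation_lt_top.ne) h
      rwa [ENNReal.toReal_mul, ENNReal.toReal_ofReal (abs_nonneg c)] at h2)

/-- The norm `‖u‖_BV = ‖u‖₁ + ‖Du‖(ℝ^d)`. -/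
instance : Norm (BV d) := ⟨fun u => ‖toL1 u‖ + (variation (u : E d → ℝ)).toReal⟩

theorem norm_def (u : BV d) : ‖u‖ = ‖toL1 u‖ + (variation (u : E d → ℝ)).toReal := rfl

theorem normCore (d : ℕ) : NormedSpace.Core ℝ (BV d) where
  norm_nonneg u := by rw [norm_def]; positivity
  norm_smul c u := by
    have h := map_smul_eq_mul (variationSeminorm d) c u
    change (variation ((c • u : BV d) : E d → ℝ)).toReal = ‖c‖ * (variation (u : E d → ℝ)).toReal
      at h
    rw [norm_def, norm_def, h, map_smul, norm_smul, mul_add]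
  norm_triangle u w := by
    have h := map_add_le_add (variationSeminorm d) u w
    change (variation ((u + w : BV d) : E d → ℝ)).toReal ≤
      (variation (u : E d → ℝ)).toReal + (variation (w : E d → ℝ)).toReal at h
    have h2 : ‖toL1 (u + w)‖ ≤ ‖toL1 u‖ + ‖toL1 w‖ := by
      rw [map_add]; exact norm_add_le _ _
    rw [norm_def, norm_def, norm_def]
    linarith
  norm_eq_zero_iff u := by
    constructor
    · intro h
      rw [norm_def] at h
      have h1 : ‖toL1 u‖ = 0 :=
        ((add_eq_zero_iff_of_nonneg (norm_nonneg _) ENNReal.toReal_nonneg).1 h).1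
      exact Subtype.ext (norm_eq_zero.1 h1)
    · rintro rfl
      have h := map_zero (variationSeminorm d)
      change (variation ((0 : BV d) : E d → ℝ)).toReal = 0 at h
      rw [norm_def, h, map_zero, norm_zero, add_zero]

instance : NormedAddCommGroup (BV d) := NormedAddCommGroup.ofCore (normCore d)

instance : NormedSpace ℝ (BV d) := NormedSpace.ofCore (normCore d)

end BV

/-- The space `L^d([0,1]^d)`. -/
abbrev Ld (d : ℕ) : Type := Lp ℝ (d : ℝ≥0∞) (volume.restrict (cube d))

/-- `α = T_f`, that is, `α(u) = ∫_{[0,1]^d} f u` (an absolutely convergent integral) for all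
`u ∈ BV([0,1]^d)`. -/
def Represents {d : ℕ} (f : Ld d) (α : StrongDual ℝ (BV d)) : Prop :=
  ∀ u : BV d, IntegrableOn (fun x => f x * u x) (cube d) ∧ α u = ∫ x in cube d, f x * u x

/-- The set of all functionals `T_f`, `f ∈ L^d([0,1]^d)`, as a linear subspace
of `BV([0,1]^d)^*`. -/
def rangeT (d : ℕ) : Submodule ℝ (StrongDual ℝ (BV d)) where
  carrier := {α | ∃ f : Ld d, Represents f α}
  zero_mem' := by
    refine ⟨0, fun u => ?_⟩
    have h : (fun x => (0 : Ld d) x * u x) =ᵐ[volume.restrict (cube d)] fun _ => 0 := by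
      filter_upwards [Lp.coeFn_zero ℝ (d : ℝ≥0∞) (volume.restrict (cube d))] with x hx
      rw [hx, Pi.zero_apply, zero_mul]
    exact ⟨(integrable_zero _ _ _).congr h.symm, by rw [integral_congr_ae h]; simp⟩
  add_mem' := by
    rintro α β ⟨f, hf⟩ ⟨g, hg⟩
    refine ⟨f + g, fun u => ?_⟩
    have h : (fun x => (f + g) x * u x) =ᵐ[volume.restrict (cube d)]
        fun x => f x * u x + g x * u x := by
      filter_upwards [Lp.coeFn_add f g] with x hx
      rw [hx, Pi.add_apply, add_mul]
    refine ⟨((hf u).1.add (hg u).1).congr h.symm, ?_⟩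
    rw [integral_congr_ae h, integral_add (hf u).1 (hg u).1, ← (hf u).2, ← (hg u).2]
    rfl
  smul_mem' := by
    rintro c α ⟨f, hf⟩
    refine ⟨c • f, fun u => ?_⟩
    have h : (fun x => (c • f) x * u x) =ᵐ[volume.restrict (cube d)]
        fun x => c * (f x * u x) := by
      filter_upwards [Lp.coeFn_smul c f] with x hx
      rw [hx, Pi.smul_apply, smul_eq_mul, mul_assoc]
    refine ⟨((hf u).1.const_mul c).congr h.symm, ?_⟩
    rw [integral_congr_ae h, integral_const_mul, ← (hf u).2]
    rfl

/-- `SCH([0,1]^d)`, the norm closure of `{T_f : f ∈ L^d([0,1]^d)}` in `BV([0,1]^d)^*`. -/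
def SCH (d : ℕ) : Submodule ℝ (StrongDual ℝ (BV d)) := (rangeT d).topologicalClosure

end StrongCharge

end

/-!
The map `f ↦ T_f` is the adjoint of the Sobolev embedding of `BV([0,1]^d)` in `L^{d/(d-1)}`. For
smooth `w` with compact support, testing the variation with the fields `∇w / √(|∇w|² + ε)` and
letting `ε → 0` gives `‖∇w‖₁ ≤ ‖Dw‖(ℝ^d)`, so that the embedding follows from the
Gagliardo–Nirenberg–Sobolev inequality (for `d = 1`, from the fundamental theorem of calculus),
because mollification does not increase the variation.

Both parts of the norm of `u` are suprema of values `T_f(u)` with `‖T_f‖ ≤ 1`: take `f = div v`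
for the variation and `f = u / |u|` for the `L¹` norm. Hence `‖u‖ ≤ 2 ‖Υ(u)‖`.

Let `L` be a continuous functional on `SCH([0,1]^d)`. Then `f ↦ L(T_f)` is continuous on `L^d`, so
`s ↦ L(T_{1_s})` is a signed measure, with a density `g ∈ L¹` by Radon–Nikodym, and
`L(T_f) = ∫ f g` for all bounded `f`. For `f = div v` this bounds the variation of `g` by `‖L‖`, so
`g ∈ BV([0,1]^d)`; and `Υ(g) = L` because bounded functions are dense in `L^d`.
-/

noncomputable section

namespace StrongCharge

open Filter Topology
open scoped NNReal Convolution Gradient InnerProductSpace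

section Variation

variable {d : ℕ} {v : E d → E d}

theorem divergence_eq_sum_fderiv {x : E d} (hv : DifferentiableAt ℝ v x) :
    divergence v x = ∑ i, fderiv ℝ (fun y => v y i) x (EuclideanSpace.single i 1) :=
  Finset.sum_congr rfl fun i _ =>
    have hcoord : fderiv ℝ (fun y => v y i) x = EuclideanSpace.proj i ∘L fderiv ℝ v x :=
      ((EuclideanSpace.proj (𝕜 := ℝ) i).hasFDerivAt.comp x hv.hasFDerivAt).fderiv
    (DFunLike.congr_fun hcoord _).symm

theorem continuous_divergence (hv : ContDiff ℝ 1 v) : Continuous (divergence v) :=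
  continuous_finsetSum _ fun i _ => (EuclideanSpace.proj (𝕜 := ℝ) i).continuous.comp
    ((hv.continuous_fderiv one_ne_zero).clm_apply continuous_const)

theorem hasCompactSupport_divergence (hv : HasCompactSupport v) :
    HasCompactSupport (divergence v) :=
  (hv.fderiv (𝕜 := ℝ)).mono fun x hx h0 => hx (by simp [divergence, h0])

theorem divergence_comp_add_right (v : E d → E d) (x y : E d) :
    divergence (fun z => v (z + y)) x = divergence v (x + y) := by
  simp [divergence, fderiv_comp_add_right]

theorem IsTestField.comp_add_right (hv : IsTestField v) (y : E d) :
    IsTestField fun z => v (z + y) where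
  contDiff := hv.contDiff.comp (contDiff_id.add contDiff_const)
  hasCompactSupport := hv.hasCompactSupport.comp_homeomorph (Homeomorph.addRight y)
  norm_le_one _ := hv.norm_le_one _

theorem IsTestField.enorm_integral_le_variation (hv : IsTestField v) (u : E d → ℝ) :
    ‖∫ x, u x * divergence v x‖ₑ ≤ variation u := by
  rw [Real.enorm_eq_ofReal_abs, abs_eq_max_neg, ENNReal.ofReal_max]
  refine max_le (le_iSup₂_of_le v hv le_rfl) (le_iSup₂_of_le (-v) hv.neg ?_)
  simp [divergence_neg, integral_neg]

theorem variation_comp_sub_right (u : E d → ℝ) (y : E d) :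
    variation (fun x => u (x - y)) = variation u := by
  have hle (u : E d → ℝ) (y : E d) : variation (fun x => u (x - y)) ≤ variation u := by
    refine iSup₂_le fun v hv => le_iSup₂_of_le _ (hv.comp_add_right y) (le_of_eq ?_)
    rw [← integral_add_right_eq_self _ y]
    simp [divergence_comp_add_right]
  refine (hle u y).antisymm ?_
  simpa using hle (fun x => u (x - y)) (-y)

end Variation

section IntegrationByParts

theorem integral_mul_fderiv_eq_neg_fderiv_mul {V : Type*} [NormedAddCommGroup V] [NormedSpace ℝ V]
    [FiniteDimensional ℝ V] [MeasurableSpace V] [BorelSpace V] {μ : Measure V} [μ.IsAddHaarMeasure]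
    {f g : V → ℝ} (hf : ContDiff ℝ 1 f) (hs : HasCompactSupport f) (hg : ContDiff ℝ 1 g) (e : V) :
    ∫ x, f x * fderiv ℝ g x e ∂μ = -∫ x, fderiv ℝ f x e * g x ∂μ := by
  have hf' : Continuous fun x => fderiv ℝ f x e :=
    (hf.continuous_fderiv one_ne_zero).clm_apply continuous_const
  have hg' : Continuous fun x => fderiv ℝ g x e :=
    (hg.continuous_fderiv one_ne_zero).clm_apply continuous_const
  exact integral_mul_fderiv_eq_neg_fderiv_mul_of_integrable
    ((hf'.mul hg.continuous).integrable_of_hasCompactSupport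
      (hs.fderiv_apply (𝕜 := ℝ) e).mul_right)
    ((hf.continuous.mul hg').integrable_of_hasCompactSupport hs.mul_right)
    ((hf.continuous.mul hg.continuous).integrable_of_hasCompactSupport hs.mul_right)
    (fun x _ => hf.differentiable one_ne_zero x) fun x _ => hg.differentiable one_ne_zero x

variable {d : ℕ} {w : E d → ℝ} {v : E d → E d}

theorem integral_mul_divergence (hw : ContDiff ℝ 1 w) (hs : HasCompactSupport w)
    (hv : ContDiff ℝ 1 v) :
    ∫ x, w x * divergence v x = -∫ x, ⟪∇ w x, v x⟫_ℝ := by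
  have hvi := contDiff_euclidean.1 hv
  have hw' (e : E d) : Continuous fun x => fderiv ℝ w x e :=
    (hw.continuous_fderiv one_ne_zero).clm_apply continuous_const
  have hvi' (i : Fin d) (e : E d) : Continuous fun x => fderiv ℝ (fun y => v y i) x e :=
    ((hvi i).continuous_fderiv one_ne_zero).clm_apply continuous_const
  have hinner (x : E d) :
      ⟪∇ w x, v x⟫_ℝ = ∑ i, fderiv ℝ w x (EuclideanSpace.single i 1) * v x i := by
    rw [inner_gradient_left]
    conv_lhs => rw [← (EuclideanSpace.basisFun (Fin d) ℝ).sum_repr (v x)]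
    simp [mul_comm]
  simp_rw [hinner, divergence_eq_sum_fderiv (hv.differentiable one_ne_zero _), Finset.mul_sum]
  rw [integral_finsetSum, integral_finsetSum, ← Finset.sum_neg_distrib]
  · exact Finset.sum_congr rfl fun i _ => integral_mul_fderiv_eq_neg_fderiv_mul hw hs (hvi i) _
  · exact fun i _ => ((hw' _).mul (hvi i).continuous).integrable_of_hasCompactSupport
      (hs.fderiv_apply (𝕜 := ℝ) _).mul_right
  · exact fun i _ => (hw.continuous.mul (hvi' i _)).integrable_of_hasCompactSupport hs.mul_right

end IntegrationByParts

section Smooth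

variable {d : ℕ}

theorem isTestField_inv_sqrt_smul {G : E d → E d} (hG : ContDiff ℝ 1 G)
    (hs : HasCompactSupport G) {ε : ℝ} (hε : 0 < ε) :
    IsTestField fun x => (√(‖G x‖ ^ 2 + ε))⁻¹ • G x where
  contDiff := by
    have hpos (x : E d) : 0 < ‖G x‖ ^ 2 + ε := by positivity
    have hroot : ContDiff ℝ 1 fun x => √(‖G x‖ ^ 2 + ε) :=
      ((hG.norm_sq ℝ).add contDiff_const).sqrt fun x => (hpos x).ne'
    have hinv : ContDiff ℝ 1 fun x => (√(‖G x‖ ^ 2 + ε))⁻¹ :=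
      hroot.inv fun x => (Real.sqrt_pos.2 (hpos x)).ne'
    exact hinv.smul hG
  hasCompactSupport := hs.smul_left (f := fun x => (√(‖G x‖ ^ 2 + ε))⁻¹)
  norm_le_one x := by
    have hroot : 0 < √(‖G x‖ ^ 2 + ε) := Real.sqrt_pos.2 (by positivity)
    rw [norm_smul, Real.norm_of_nonneg (inv_nonneg.2 hroot.le), inv_mul_le_one₀ hroot]
    exact Real.le_sqrt_of_sq_le (by linarith)

theorem tendsto_inv_sqrt_sq_add_mul_sq {a : ℝ} (ha : 0 ≤ a) :
    Tendsto (fun ε : ℝ => (√(a ^ 2 + ε))⁻¹ * a ^ 2) (𝓝 0) (𝓝 a) := by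
  rcases ha.eq_or_lt with rfl | ha
  · simp
  have hcont : ContinuousAt (fun ε : ℝ => (√(a ^ 2 + ε))⁻¹ * a ^ 2) 0 := by
    refine ContinuousAt.mul (ContinuousAt.inv₀ (by fun_prop) ?_) continuousAt_const
    simp [ha.ne', Real.sqrt_sq ha.le]
  convert hcont.tendsto using 2
  rw [add_zero, Real.sqrt_sq ha.le]
  field_simp

theorem contDiff_gradient {V : Type*} [NormedAddCommGroup V] [InnerProductSpace ℝ V]
    [CompleteSpace V] {w : V → ℝ} {n : WithTop ℕ∞} (hw : ContDiff ℝ (n + 1) w) :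
    ContDiff ℝ n (∇ w) :=
  (InnerProductSpace.toDual ℝ V).symm.contDiff.comp (hw.fderiv_right le_rfl)

theorem hasCompactSupport_gradient {V : Type*} [NormedAddCommGroup V] [InnerProductSpace ℝ V]
    [CompleteSpace V] {w : V → ℝ} (hs : HasCompactSupport w) : HasCompactSupport (∇ w) :=
  (hs.fderiv (𝕜 := ℝ)).comp_left (map_zero (InnerProductSpace.toDual ℝ V).symm)

theorem eLpNorm_inv_sqrt_mul_le_variation {w : E d → ℝ} (hw : ContDiff ℝ 2 w)
    (hs : HasCompactSupport w) {ε : ℝ} (hε : 0 < ε) :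
    eLpNorm (fun x => (√(‖∇ w x‖ ^ 2 + ε))⁻¹ * ‖∇ w x‖ ^ 2) 1 volume ≤ variation w := by
  have hfield := isTestField_inv_sqrt_smul (contDiff_gradient (n := 1) hw)
    (hasCompactSupport_gradient hs) hε
  have hinner (x : E d) : ⟪∇ w x, (√(‖∇ w x‖ ^ 2 + ε))⁻¹ • ∇ w x⟫_ℝ =
      (√(‖∇ w x‖ ^ 2 + ε))⁻¹ * ‖∇ w x‖ ^ 2 := by
    rw [real_inner_smul_right, real_inner_self_eq_norm_sq]
  have hint : Integrable fun x => ⟪∇ w x, (√(‖∇ w x‖ ^ 2 + ε))⁻¹ • ∇ w x⟫_ℝ :=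
    ((contDiff_gradient (n := 1) hw).continuous.inner
      hfield.contDiff.continuous).integrable_of_hasCompactSupport
      (hfield.hasCompactSupport.mono fun x hx h0 => hx (by simp [h0]))
  simp only [hinner] at hint
  refine le_trans (le_of_eq ?_) (hfield.enorm_integral_le_variation w)
  rw [integral_mul_divergence (hw.of_le one_le_two) hs hfield.contDiff, enorm_neg,
    eLpNorm_one_eq_lintegral_enorm]
  simp only [hinner]
  have hnonneg (x : E d) : 0 ≤ (√(‖∇ w x‖ ^ 2 + ε))⁻¹ * ‖∇ w x‖ ^ 2 := by positivity
  rw [Real.enorm_of_nonneg (integral_nonneg hnonneg), lintegral_enorm_of_nonneg hnonneg,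
    ofReal_integral_eq_lintegral_ofReal hint (Eventually.of_forall hnonneg)]

theorem eLpNorm_fderiv_le_variation {w : E d → ℝ} (hw : ContDiff ℝ 2 w)
    (hs : HasCompactSupport w) : eLpNorm (fderiv ℝ w) 1 volume ≤ variation w := by
  have hG := (contDiff_gradient (n := 1) hw).continuous
  have hnorm : eLpNorm (fderiv ℝ w) 1 volume = eLpNorm (fun x => ‖∇ w x‖) 1 volume :=
    eLpNorm_congr_norm_ae (Eventually.of_forall fun x => by
      rw [norm_norm, gradient, LinearIsometryEquiv.norm_map])
  rw [hnorm]
  exact Lp.eLpNorm_le_of_ae_tendsto (u := 𝓝[>] (0 : ℝ))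
    (eventually_mem_nhdsWithin.mono fun ε hε => eLpNorm_inv_sqrt_mul_le_variation hw hs hε)
    (fun ε => by fun_prop)
    (Eventually.of_forall fun x =>
      (tendsto_inv_sqrt_sq_add_mul_sq (norm_nonneg _)).mono_left nhdsWithin_le_nhds)

end Smooth

section Convolution

variable {d : ℕ}

theorem variation_convolution_le {φ u : E d → ℝ} (hφ : Integrable φ) (hu : Integrable u) :
    variation (φ ⋆[ContinuousLinearMap.lsmul ℝ ℝ, volume] u) ≤
      eLpNorm φ 1 volume * variation u := by
  refine iSup₂_le fun v hv => (Real.ofReal_le_enorm _).trans ?_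
  have hint : Integrable (fun p : E d × E d => φ p.2 * u (p.1 - p.2) * divergence v p.1)
      (volume.prod volume) := by
    obtain ⟨C, hC⟩ := (hasCompactSupport_divergence hv.hasCompactSupport).exists_bound_of_continuous
      (continuous_divergence hv.contDiff)
    refine (hφ.convolution_integrand (ContinuousLinearMap.lsmul ℝ ℝ) hu).mul_bdd (c := C) ?_
      (Eventually.of_forall fun p => hC _)
    exact ((continuous_divergence hv.contDiff).comp continuous_fst).aestronglyMeasurable
  calc ‖∫ x, (φ ⋆[ContinuousLinearMap.lsmul ℝ ℝ, volume] u) x * divergence v x‖ₑ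
      = ‖∫ x, ∫ y, φ y * u (x - y) * divergence v x‖ₑ := by
        simp only [convolution, ContinuousLinearMap.lsmul_apply, smul_eq_mul, integral_mul_const]
    _ = ‖∫ y, φ y * ∫ x, u (x - y) * divergence v x‖ₑ := by
        rw [integral_integral_swap hint]
        simp only [mul_assoc, integral_const_mul]
    _ ≤ ∫⁻ y, ‖φ y * ∫ x, u (x - y) * divergence v x‖ₑ := enorm_integral_le_lintegral_enorm _
    _ ≤ ∫⁻ y, ‖φ y‖ₑ * variation u := by
        refine lintegral_mono fun y => ?_
        rw [enorm_mul, ← variation_comp_sub_right u y]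
        gcongr
        exact hv.enorm_integral_le_variation _
    _ = eLpNorm φ 1 volume * variation u := by
        rw [lintegral_mul_const'' _ hφ.1.enorm, eLpNorm_one_eq_lintegral_enorm]

theorem eLpNorm_normed_one {V : Type*} [NormedAddCommGroup V] [NormedSpace ℝ V]
    [HasContDiffBump V] [FiniteDimensional ℝ V] [MeasurableSpace V] [BorelSpace V] {c : V}
    (φ : ContDiffBump c) (μ : Measure V) [IsLocallyFiniteMeasure μ] [μ.IsOpenPosMeasure] :
    eLpNorm (φ.normed μ) 1 μ = 1 := by
  rw [eLpNorm_one_eq_lintegral_enorm, lintegral_enorm_of_nonneg φ.nonneg_normed,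
    ← ofReal_integral_eq_lintegral_ofReal φ.integrable_normed
      (Eventually.of_forall φ.nonneg_normed), φ.integral_normed, ENNReal.ofReal_one]

theorem variation_normed_convolution_le (φ : ContDiffBump (0 : E d)) {u : E d → ℝ}
    (hu : Integrable u) :
    variation (φ.normed volume ⋆[ContinuousLinearMap.lsmul ℝ ℝ, volume] u) ≤ variation u := by
  simpa [eLpNorm_normed_one] using variation_convolution_le φ.integrable_normed hu

end Convolution

section Sobolev

section

variable {V : Type*} [NormedAddCommGroup V] [InnerProductSpace ℝ V] [FiniteDimensional ℝ V]
  [MeasurableSpace V] [BorelSpace V] {F : Type*} [NormedAddCommGroup F] [NormedSpace ℝ F]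

theorem eLpNorm_top_le_eLpNorm_fderiv_one (hV : Module.finrank ℝ V = 1) {w : V → F}
    (hw : ContDiff ℝ 1 w) (hs : HasCompactSupport w) :
    eLpNorm w ∞ volume ≤ eLpNorm (fderiv ℝ w) 1 volume := by
  obtain ⟨e, he⟩ : ∃ e : V, ‖e‖ = 1 :=
    have : Nontrivial V := Module.nontrivial_of_finrank_pos (R := ℝ) (by omega)
    exists_norm_eq V zero_le_one
  let γ : ℝ ≃ₗᵢ[ℝ] V :=
    (LinearIsometry.toSpanSingleton ℝ V he).toLinearIsometryEquiv (by simp [hV])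
  have hderiv (s : ℝ) : deriv (w ∘ γ) s = fderiv ℝ w (γ s) e := by
    have hγ : HasDerivAt γ e s := by
      simpa [γ] using (γ : ℝ →L[ℝ] V).hasFDerivAt.hasDerivAt (x := s)
    exact ((hw.differentiable one_ne_zero (γ s)).hasFDerivAt.comp_hasDerivAt s hγ).deriv
  rw [eLpNorm_exponent_top, eLpNorm_one_eq_lintegral_enorm]
  refine eLpNormEssSup_le_of_ae_enorm_bound (Eventually.of_forall fun x => ?_)
  obtain ⟨t, rfl⟩ := γ.surjective x
  calc ‖w (γ t)‖ₑ ≤ ∫⁻ s in Set.Iic t, ‖deriv (w ∘ γ) s‖ₑ :=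
        HasCompactSupport.enorm_le_lintegral_Ici_deriv (hw.comp γ.contDiff)
          (hs.comp_homeomorph γ.toHomeomorph) t
    _ ≤ ∫⁻ s, ‖deriv (w ∘ γ) s‖ₑ := setLIntegral_le_lintegral _ _
    _ ≤ ∫⁻ s, ‖fderiv ℝ w (γ s)‖ₑ := lintegral_mono fun s => by
        rw [hderiv]
        simpa [← enorm_norm e, he] using (fderiv ℝ w (γ s)).le_opENorm e
    _ = ∫⁻ x, ‖fderiv ℝ w x‖ₑ :=
        γ.measurePreserving.lintegral_comp_emb γ.toHomeomorph.measurableEmbedding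
          (fun x => ‖fderiv ℝ w x‖ₑ)

theorem exists_eLpNorm_conjExponent_le_eLpNorm_fderiv (hV : 1 ≤ Module.finrank ℝ V) :
    ∃ C : ℝ≥0, ∀ w : V → F, ContDiff ℝ 1 w → HasCompactSupport w →
      eLpNorm w (ENNReal.conjExponent (Module.finrank ℝ V)) volume ≤
        C * eLpNorm (fderiv ℝ w) 1 volume := by
  rcases hV.eq_or_lt with hV | hV
  · refine ⟨1, fun w hw hs => ?_⟩
    simpa [← hV, ENNReal.conjExponent] using eLpNorm_top_le_eLpNorm_fderiv_one hV.symm hw hs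
  · refine ⟨eLpNormLESNormFDerivOneConst (volume : Measure V)
      (NNReal.conjExponent (Module.finrank ℝ V)), fun w hw hs => ?_⟩
    have hdim : (1 : ℝ≥0) < Module.finrank ℝ V := by exact_mod_cast hV
    have hexp : ENNReal.conjExponent (Module.finrank ℝ V) =
        (NNReal.conjExponent (Module.finrank ℝ V) : ℝ≥0) := by
      rw [ENNReal.coe_conjExponent hdim, ENNReal.coe_natCast]
    rw [hexp]
    exact eLpNorm_le_eLpNorm_fderiv_one volume hw hs (.conjExponent hdim)

end

variable {d : ℕ}

theorem exists_eLpNorm_conjExponent_le_variation (hd : 1 ≤ d) :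
    ∃ C : ℝ≥0, ∀ u : E d → ℝ, Integrable u → HasCompactSupport u →
      eLpNorm u (ENNReal.conjExponent d) volume ≤ C * variation u := by
  obtain ⟨C, hC⟩ := exists_eLpNorm_conjExponent_le_eLpNorm_fderiv (V := E d) (F := ℝ) (by simpa)
  rw [finrank_euclideanSpace_fin] at hC
  refine ⟨C, fun u hu hs => ?_⟩
  let φ (n : ℕ) : ContDiffBump (0 : E d) :=
    ⟨1 / ((n : ℝ) + 1), 2 * (1 / ((n : ℝ) + 1)), by positivity,
      lt_two_mul_self (by positivity)⟩
  let w (n : ℕ) : E d → ℝ := (φ n).normed volume ⋆[ContinuousLinearMap.lsmul ℝ ℝ, volume] u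
  have hw_smooth (n : ℕ) : ContDiff ℝ 2 (w n) :=
    ((φ n).hasCompactSupport_normed (μ := volume)).contDiff_convolution_left (n := 2) _
      (φ n).contDiff_normed hu.locallyIntegrable
  have hw_supp (n : ℕ) : HasCompactSupport (w n) :=
    ((φ n).hasCompactSupport_normed (μ := volume)).convolution (μ := volume) _ hs
  have hw_tendsto : ∀ᵐ x, Tendsto (w · x) atTop (𝓝 (u x)) :=
    ContDiffBump.ae_convolution_tendsto_right_of_locallyIntegrable (K := 2)
      (by simpa [φ] using (tendsto_one_div_add_atTop_nhds_zero_nat (𝕜 := ℝ)).const_mul 2)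
      (Eventually.of_forall fun n => le_rfl) hu.locallyIntegrable
  refine Lp.eLpNorm_le_of_ae_tendsto (Eventually.of_forall fun n => ?_)
    (fun n => (hw_smooth n).continuous.aestronglyMeasurable) hw_tendsto
  calc eLpNorm (w n) (ENNReal.conjExponent d) volume
      ≤ C * eLpNorm (fderiv ℝ (w n)) 1 volume :=
        hC (w n) ((hw_smooth n).of_le one_le_two) (hw_supp n)
    _ ≤ C * variation (w n) := by
        gcongr
        exact eLpNorm_fderiv_le_variation (hw_smooth n) (hw_supp n)
    _ ≤ C * variation u := by gcongr; exact variation_normed_convolution_le _ hu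

end Sobolev

section LpDual

variable {α : Type*} {m : MeasurableSpace α} {μ : Measure α} [IsFiniteMeasure μ] {p : ℝ≥0∞}

section

variable {F : Type*} [NormedAddCommGroup F]

theorem indicatorConstLp_biUnion_finset {ι : Type*} {s : ι → Set α}
    (hs : ∀ i, MeasurableSet (s i)) (hd : Pairwise (Function.onFun Disjoint s)) (t : Finset ι)
    (c : F) :
    indicatorConstLp p (t.measurableSet_biUnion fun i _ => hs i) (measure_ne_top μ _) c =
      ∑ i ∈ t, indicatorConstLp p (hs i) (measure_ne_top μ _) c := by
  classical
  induction t using Finset.induction_on with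
  | empty => simp
  | insert a t ha ih =>
    have hdisj : Disjoint (s a) (⋃ i ∈ t, s i) :=
      Set.disjoint_iUnion₂_right.2 fun i hi => hd (ne_of_mem_of_not_mem hi ha).symm
    rw [Finset.sum_insert ha, ← ih, ← indicatorConstLp_disjoint_union _ _ _ _ hdisj]
    congr 1
    simp

variable [Fact (1 ≤ p)]

theorem hasSum_indicatorConstLp (hp : p ≠ ∞) {ι : Type*} [Countable ι] {s : ι → Set α}
    (hs : ∀ i, MeasurableSet (s i)) (hd : Pairwise (Function.onFun Disjoint s)) (c : F) :
    HasSum (fun i => indicatorConstLp p (hs i) (measure_ne_top μ _) c)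
      (indicatorConstLp p (MeasurableSet.iUnion hs) (measure_ne_top μ _) c) := by
  simp only [HasSum, ← indicatorConstLp_biUnion_finset hs hd,
    SummationFilter.unconditional_filter]
  refine tendsto_indicatorConstLp_set hp ?_
  have hsub (t : Finset ι) : (⋃ i ∈ t, s i) ⊆ ⋃ i, s i :=
    Set.iUnion₂_subset fun i _ => Set.subset_iUnion s i
  have hdiff (t : Finset ι) :
      μ (symmDiff (⋃ i ∈ t, s i) (⋃ i, s i)) = μ (⋃ i, s i) - ∑ i ∈ t, μ (s i) := by
    rw [symmDiff_of_le (hsub t), measure_sdiff (hsub t)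
      (t.measurableSet_biUnion fun i _ => hs i).nullMeasurableSet (measure_ne_top _ _),
      measure_biUnion_finset (fun i _ j _ hij => hd hij) fun i _ => hs i]
  have hsum : Tendsto (fun t : Finset ι => ∑ i ∈ t, μ (s i)) atTop (𝓝 (μ (⋃ i, s i))) := by
    rw [measure_iUnion hd hs]
    exact ENNReal.summable.hasSum
  simp only [hdiff]
  simpa using ENNReal.Tendsto.sub (tendsto_const_nhds (x := μ (⋃ i, s i))) hsum
    (Or.inl (measure_ne_top μ _))

open Classical in
/-- The vector measure `s ↦ 1_s c` with values in `Lᵖ`, for `p < ∞` (σ-additivity fails in `L^∞`).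
Its image under a continuous functional is the signed measure to which Radon–Nikodym is applied. -/
def indicatorVectorMeasure (μ : Measure α) [IsFiniteMeasure μ] (hp : p ≠ ∞) (c : F) :
    VectorMeasure α (Lp F p μ) where
  measureOf' s := if hs : MeasurableSet s then indicatorConstLp p hs (measure_ne_top μ s) c else 0
  empty' := by simp
  not_measurable' s hs := dif_neg hs
  m_iUnion' s hs hd := by
    simpa only [hs, MeasurableSet.iUnion hs, dif_pos] using hasSum_indicatorConstLp hp hs hd c

theorem indicatorVectorMeasure_apply (hp : p ≠ ∞) (c : F) {s : Set α} (hs : MeasurableSet s) :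
    indicatorVectorMeasure μ hp c s = indicatorConstLp p hs (measure_ne_top μ s) c :=
  dif_pos hs

theorem indicatorVectorMeasure_absolutelyContinuous (hp : p ≠ ∞) (c : F) :
    indicatorVectorMeasure μ hp c ≪ᵥ μ.toENNRealVectorMeasure := by
  refine .mk fun s hs hμs => ?_
  rw [Measure.toENNRealVectorMeasure_apply_measurable hs] at hμs
  have hp0 := (zero_lt_one.trans_le (Fact.out : 1 ≤ p)).ne'
  rw [indicatorVectorMeasure_apply hp c hs, ← norm_eq_zero, norm_indicatorConstLp hp0 hp]
  simp [measureReal_def, hμs, (ENNReal.toReal_pos hp0 hp).ne']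

end

variable [Fact (1 ≤ p)]

theorem exists_integrable_apply_indicatorConstLp_eq_setIntegral (hp : p ≠ ∞)
    (ℓ : StrongDual ℝ (Lp ℝ p μ)) :
    ∃ g : α → ℝ, Integrable g μ ∧ ∀ (s : Set α) (hs : MeasurableSet s),
      ℓ (indicatorConstLp p hs (measure_ne_top μ s) 1) = ∫ x in s, g x ∂μ := by
  let ν : SignedMeasure α := (indicatorVectorMeasure μ hp (1 : ℝ)).mapRange ℓ ℓ.continuous
  have hν : ν ≪ᵥ μ.toENNRealVectorMeasure := fun s hs =>
    (congrArg ℓ (indicatorVectorMeasure_absolutelyContinuous hp 1 hs)).trans (map_zero ℓ)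
  refine ⟨ν.rnDeriv μ, SignedMeasure.integrable_rnDeriv _ _, fun s hs => ?_⟩
  rw [← indicatorVectorMeasure_apply hp 1 hs,
    ← withDensityᵥ_apply (SignedMeasure.integrable_rnDeriv ν μ) hs,
    SignedMeasure.withDensityᵥ_rnDeriv_eq ν μ hν]
  rfl

theorem apply_toLp_simpleFunc_eq_integral {ℓ : StrongDual ℝ (Lp ℝ p μ)} {g : α → ℝ}
    (hg : Integrable g μ) (hℓ : ∀ (s : Set α) (hs : MeasurableSet s),
      ℓ (indicatorConstLp p hs (measure_ne_top μ s) 1) = ∫ x in s, g x ∂μ)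
    (f : SimpleFunc α ℝ) (hf : MemLp f p μ) :
    ℓ (hf.toLp f) = ∫ x, f x * g x ∂μ := by
  induction f using SimpleFunc.induction with
  | @const c s hs =>
    have hind : hf.toLp _ =
        c • indicatorConstLp p hs (measure_ne_top μ s) (1 : ℝ) := by
      rw [indicatorConstLp, ← MemLp.toLp_const_smul]
      refine MemLp.toLp_congr _ _ (Eventually.of_forall fun x => ?_)
      by_cases hx : x ∈ s <;> simp [hx]
    rw [hind, map_smul, hℓ, smul_eq_mul, ← integral_indicator hs, ← integral_const_mul]
    refine integral_congr_ae (Eventually.of_forall fun x => ?_)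
    by_cases hx : x ∈ s <;> simp [hx]
  | @add f₁ f₂ _ h₁ h₂ =>
    have hf₁ : MemLp f₁ p μ := f₁.memLp_of_isFiniteMeasure p μ
    have hf₂ : MemLp f₂ p μ := f₂.memLp_of_isFiniteMeasure p μ
    have hadd : hf.toLp _ = hf₁.toLp f₁ + hf₂.toLp f₂ := MemLp.toLp_add hf₁ hf₂
    have hint (f : SimpleFunc α ℝ) : Integrable (fun x => f x * g x) μ := hg.simpleFunc_mul f
    rw [hadd, map_add, h₁ hf₁, h₂ hf₂, ← integral_add (hint f₁) (hint f₂)]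
    simp [add_mul]

theorem exists_integrable_apply_toLp_eq_integral (hp : p ≠ ∞) (ℓ : StrongDual ℝ (Lp ℝ p μ)) :
    ∃ g : α → ℝ, Integrable g μ ∧ ∀ (f : α → ℝ) (hf : MemLp f p μ), MemLp f ∞ μ →
      ℓ (hf.toLp f) = ∫ x, f x * g x ∂μ := by
  obtain ⟨g, hg, hℓ⟩ := exists_integrable_apply_indicatorConstLp_eq_setIntegral hp ℓ
  refine ⟨g, hg, fun f hf hf_top => ?_⟩
  obtain ⟨f', hf'_meas, hff'⟩ := hf.1.aemeasurable
  have hf' : MemLp f' p μ := hf.ae_eq hff'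
  rw [MemLp.toLp_congr hf hf' hff', integral_congr_ae (hff'.mono fun x hx => by rw [hx])]
  let F (n : ℕ) := SimpleFunc.approxOn f' hf'_meas (Set.range f' ∪ {0}) 0 (by simp) n
  have hℓ_lim := (ℓ.continuous.tendsto _).comp
    (SimpleFunc.tendsto_approxOn_range_Lp hp hf'_meas hf')
  have hint_lim : Tendsto (fun n => ∫ x, F n x * g x ∂μ) atTop (𝓝 (∫ x, f' x * g x ∂μ)) := by
    have hbound : ∀ᵐ x ∂μ, ‖f' x‖ ≤ (eLpNorm f' ∞ μ).toReal := by
      have hfin := (hf_top.ae_eq hff').2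
      rw [eLpNorm_exponent_top] at hfin ⊢
      filter_upwards [ae_le_eLpNormEssSup (f := f')] with x hx
      exact toReal_enorm (f' x) ▸ ENNReal.toReal_mono hfin.ne hx
    refine tendsto_integral_of_dominated_convergence
      (fun x => ((eLpNorm f' ∞ μ).toReal + (eLpNorm f' ∞ μ).toReal) * ‖g x‖)
      (fun n => (F n).aestronglyMeasurable.mul hg.1) (hg.norm.const_mul _)
      (fun n => hbound.mono fun x hx => ?_) (Eventually.of_forall fun x => ?_)
    · rw [norm_mul]
      gcongr
      exact (SimpleFunc.norm_approxOn_zero_le hf'_meas _ x n).trans (add_le_add hx hx)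
    · exact (SimpleFunc.tendsto_approxOn hf'_meas _ (subset_closure (by simp))).mul_const _
  exact tendsto_nhds_unique hℓ_lim
    (hint_lim.congr fun n => (apply_toLp_simpleFunc_eq_integral hg hℓ (F n) _).symm)

end LpDual

section Cube

variable {d : ℕ}

theorem isCompact_cube (d : ℕ) : IsCompact (cube d) := by
  have hcube : cube d = EuclideanSpace.equiv (Fin d) ℝ ⁻¹' Set.univ.pi fun _ => Set.Icc 0 1 := by
    ext x
    exact ⟨fun h i _ => h i, fun h i => h i trivial⟩
  rw [hcube]
  exact (EuclideanSpace.equiv (Fin d) ℝ).toHomeomorph.isCompact_preimage.2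
    (isCompact_univ_pi fun _ => isCompact_Icc)

theorem measurableSet_cube (d : ℕ) : MeasurableSet (cube d) :=
  (isCompact_cube d).measurableSet

instance isFiniteMeasure_restrict_cube (d : ℕ) :
    IsFiniteMeasure ((volume : Measure (E d)).restrict (cube d)) :=
  isFiniteMeasure_restrict.2 (isCompact_cube d).measure_ne_top

theorem IsTestField.memLp_divergence {v : E d → E d} (hv : IsTestField v) (p : ℝ≥0∞)
    (μ : Measure (E d)) [IsFiniteMeasureOnCompacts μ] : MemLp (divergence v) p μ :=
  (continuous_divergence hv.contDiff).memLp_of_hasCompactSupport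
    (hasCompactSupport_divergence hv.hasCompactSupport)

namespace BV

theorem integrable (u : BV d) : Integrable (u : E d → ℝ) := L1.integrable_coeFn _

theorem indicator_ae_eq (u : BV d) : (cube d).indicator (u : E d → ℝ) =ᵐ[volume] u :=
  indicator_ae_eq_of_restrict_compl_ae_eq_zero (measurableSet_cube d)
    ((ae_restrict_iff' (measurableSet_cube d).compl).2 u.2.1)

theorem setIntegral_mul (u : BV d) (f : E d → ℝ) :
    ∫ x in cube d, f x * u x = ∫ x, u x * f x := by
  rw [← integral_indicator (measurableSet_cube d)]
  refine integral_congr_ae (u.indicator_ae_eq.mono fun x hx => ?_)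
  simp only [Set.indicator_mul_right, hx, mul_comm]

theorem norm_toL1_eq_integral_norm (u : BV d) : ‖toL1 u‖ = ∫ x, ‖u x‖ :=
  L1.norm_eq_integral_norm _

theorem norm_toL1_le (u : BV d) : ‖toL1 u‖ ≤ ‖u‖ :=
  le_add_of_nonneg_right ENNReal.toReal_nonneg

theorem variation_le_enorm (u : BV d) : variation (u : E d → ℝ) ≤ ‖u‖ₑ := by
  rw [← ofReal_norm, ← ENNReal.ofReal_toReal u.variation_lt_top.ne, norm_def]
  exact ENNReal.ofReal_le_ofReal (le_add_of_nonneg_left (norm_nonneg _))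

theorem exists_ae_eq_indicator {g : E d → ℝ} (hg : IntegrableOn g (cube d))
    (hv : variation ((cube d).indicator g) < ∞) :
    ∃ u : BV d, (u : E d → ℝ) =ᵐ[volume] (cube d).indicator g := by
  have hind : Integrable ((cube d).indicator g) :=
    (integrable_indicator_iff (measurableSet_cube d)).2 hg
  refine ⟨⟨hind.toL1 _, ?_, ?_⟩, hind.coeFn_toL1⟩
  · exact hind.coeFn_toL1.mono fun x hx hxc => by rw [hx, Set.indicator_of_notMem hxc]
  · rwa [variation_congr hind.coeFn_toL1]

end BV

end Cube

section Functionals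

instance fact_one_le_conjExponent (p : ℝ≥0∞) : Fact (1 ≤ ENNReal.conjExponent p) := ⟨le_self_add⟩

variable {d : ℕ} [Fact (1 ≤ (d : ℝ≥0∞))]

theorem BV.exists_eLpNorm_conjExponent_le (d : ℕ) [Fact (1 ≤ (d : ℝ≥0∞))] :
    ∃ C : ℝ≥0, ∀ u : BV d,
      eLpNorm u (ENNReal.conjExponent d) (volume.restrict (cube d)) ≤ C * ‖u‖ₑ := by
  obtain ⟨C, hC⟩ := exists_eLpNorm_conjExponent_le_variation (d := d)
    (Nat.one_le_cast.1 (Fact.out : 1 ≤ (d : ℝ≥0∞)))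
  refine ⟨C, fun u => ?_⟩
  have hsupp : HasCompactSupport ((cube d).indicator (u : E d → ℝ)) :=
    .of_support_subset_isCompact (isCompact_cube d) Set.support_indicator_subset
  calc eLpNorm u (ENNReal.conjExponent d) (volume.restrict (cube d))
      = eLpNorm ((cube d).indicator (u : E d → ℝ)) (ENNReal.conjExponent d) volume :=
        (eLpNorm_indicator_eq_eLpNorm_restrict (measurableSet_cube d)).symm
    _ ≤ C * variation ((cube d).indicator (u : E d → ℝ)) :=
        hC _ (u.integrable.indicator (measurableSet_cube d)) hsupp
    _ ≤ C * ‖u‖ₑ := by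
        rw [variation_congr u.indicator_ae_eq]
        gcongr
        exact u.variation_le_enorm

theorem BV.memLp_conjExponent (u : BV d) :
    MemLp u (ENNReal.conjExponent d) (volume.restrict (cube d)) := by
  obtain ⟨C, hC⟩ := BV.exists_eLpNorm_conjExponent_le d
  exact ⟨u.integrable.1.restrict,
    (hC u).trans_lt (ENNReal.mul_lt_top ENNReal.coe_lt_top enorm_lt_top)⟩

/-- The Sobolev embedding of `BV([0,1]^d)` in `L^{d/(d-1)}([0,1]^d)`; the exponent is written
`ENNReal.conjExponent d`, which is `∞` for `d = 1`. -/
def BV.toLp (d : ℕ) [Fact (1 ≤ (d : ℝ≥0∞))] :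
    BV d →L[ℝ] Lp ℝ (ENNReal.conjExponent d) (volume.restrict (cube d)) :=
  LinearMap.mkContinuousOfExistsBound
    { toFun u := u.memLp_conjExponent.toLp u
      map_add' u w := by
        rw [← MemLp.toLp_add]
        exact MemLp.toLp_congr _ _ (ae_restrict_of_ae (Lp.coeFn_add (BV.toL1 u) (BV.toL1 w)))
      map_smul' c u := by
        rw [← MemLp.toLp_const_smul]
        exact MemLp.toLp_congr _ _ (ae_restrict_of_ae (Lp.coeFn_smul c (BV.toL1 u))) } <| by
    obtain ⟨C, hC⟩ := BV.exists_eLpNorm_conjExponent_le d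
    refine ⟨C, fun u => ?_⟩
    simpa using ENNReal.toReal_mono
      (ENNReal.mul_ne_top ENNReal.coe_ne_top enorm_ne_top) (hC u)

/-- The map `f ↦ T_f`, as the adjoint of the Sobolev embedding. -/
def toBVDual (d : ℕ) [Fact (1 ≤ (d : ℝ≥0∞))] : Ld d →L[ℝ] StrongDual ℝ (BV d) :=
  (BV.toLp d).precomp ℝ ∘L
    (ContinuousLinearMap.mul ℝ ℝ).lpPairing (volume.restrict (cube d)) d (ENNReal.conjExponent d)

theorem toBVDual_apply (f : Ld d) (u : BV d) :
    toBVDual d f u = ∫ x in cube d, f x * u x :=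
  (ContinuousLinearMap.lpPairing_eq_integral _ _ _).trans
    (integral_congr_ae (u.memLp_conjExponent.coeFn_toLp.mono fun x hx => congrArg (f x * ·) hx))

theorem represents_toBVDual (f : Ld d) : Represents f (toBVDual d f) := fun u =>
  ⟨(Lp.memLp f).integrable_mul u.memLp_conjExponent, toBVDual_apply f u⟩

theorem Represents.eq_toBVDual {f : Ld d} {α : StrongDual ℝ (BV d)} (h : Represents f α) :
    α = toBVDual d f :=
  ContinuousLinearMap.ext fun u => (h u).2.trans (toBVDual_apply f u).symm

/-- The map `f ↦ T_f` with values in `SCH([0,1]^d)`. -/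
def toSCH (d : ℕ) [Fact (1 ≤ (d : ℝ≥0∞))] : Ld d →L[ℝ] SCH d :=
  (toBVDual d).codRestrict (SCH d) fun f =>
    (rangeT d).le_topologicalClosure ⟨f, represents_toBVDual f⟩

theorem denseRange_toSCH : DenseRange (toSCH d) := by
  intro α
  rw [closure_subtype]
  refine closure_mono ?_ α.2
  rintro _ ⟨f, hf⟩
  exact ⟨_, ⟨f, rfl⟩, hf.eq_toBVDual.symm⟩

theorem toSCH_toLp_apply {f : E d → ℝ} (hf : MemLp f d (volume.restrict (cube d))) (u : BV d) :
    (toSCH d (hf.toLp f) : StrongDual ℝ (BV d)) u = ∫ x, u x * f x := by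
  refine (toBVDual_apply _ u).trans (.trans (integral_congr_ae ?_) (u.setIntegral_mul f))
  exact hf.coeFn_toLp.mono fun x hx => congrArg (· * u x) hx

theorem enorm_toSCH_toLp_le_one {f : E d → ℝ} (hf : MemLp f d (volume.restrict (cube d)))
    (h : ∀ u : BV d, ‖∫ x, u x * f x‖ₑ ≤ ‖u‖ₑ) : ‖toSCH d (hf.toLp f)‖ₑ ≤ 1 := by
  refine ContinuousLinearMap.opENorm_le_bound _ fun u => ?_
  simpa [toSCH_toLp_apply hf u] using h u

theorem IsTestField.enorm_toSCH_divergence_le_one {v : E d → E d} (hv : IsTestField v) :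
    ‖toSCH d ((hv.memLp_divergence _ _).toLp _)‖ₑ ≤ 1 :=
  enorm_toSCH_toLp_le_one _ fun u =>
    (hv.enorm_integral_le_variation u).trans u.variation_le_enorm

theorem enorm_toSCH_toLp_le_one_of_forall_norm_le_one {f : E d → ℝ}
    (hf : MemLp f d (volume.restrict (cube d))) (hf_le : ∀ x, ‖f x‖ ≤ 1) :
    ‖toSCH d (hf.toLp f)‖ₑ ≤ 1 := by
  refine enorm_toSCH_toLp_le_one hf fun u => enorm_le_iff_norm_le.2 ?_
  refine le_trans ?_ u.norm_toL1_le
  rw [u.norm_toL1_eq_integral_norm]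
  refine norm_integral_le_of_norm_le u.integrable.norm (Eventually.of_forall fun x => ?_)
  rw [norm_mul]
  exact mul_le_of_le_one_right (norm_nonneg _) (hf_le x)

theorem SCH.dual_ext {L₁ L₂ : StrongDual ℝ (SCH d)}
    (h : ∀ (f : E d → ℝ) (hf : MemLp f d (volume.restrict (cube d))),
      MemLp f ∞ (volume.restrict (cube d)) →
        L₁ (toSCH d (hf.toLp f)) = L₂ (toSCH d (hf.toLp f))) :
    L₁ = L₂ := by
  have hLd (f : Ld d) : L₁ (toSCH d f) = L₂ (toSCH d f) := by
    refine congrFun ((Lp.simpleFunc.denseRange (ENNReal.natCast_ne_top d)).equalizer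
      (L₁ ∘L toSCH d).continuous (L₂ ∘L toSCH d).continuous (funext fun s => ?_)) f
    have hs := h _ (Lp.simpleFunc.memLp s) ((Lp.simpleFunc.toSimpleFunc s).memLp_top _)
    rwa [← Lp.simpleFunc.toLp_eq_toLp, Lp.simpleFunc.toLp_toSimpleFunc] at hs
  exact DFunLike.coe_injective
    (denseRange_toSCH.equalizer L₁.continuous L₂.continuous (funext hLd))

theorem variation_le_enorm_of_forall_apply_divergence_eq {L : StrongDual ℝ (SCH d)}
    {u : E d → ℝ} (h : ∀ (v : E d → E d) (hv : IsTestField v),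
      L (toSCH d ((hv.memLp_divergence _ _).toLp _)) = ∫ x, u x * divergence v x) :
    variation u ≤ ‖L‖ₑ := by
  refine iSup₂_le fun v hv => (Real.ofReal_le_enorm _).trans ?_
  rw [← h v hv]
  exact (L.le_opENorm _).trans (mul_le_of_le_one_right' hv.enorm_toSCH_divergence_le_one)

end Functionals

section CanonicalMap

/-- The canonical map `Υ : BV([0,1]^d) → SCH([0,1]^d)^*`, `Υ(u)(α) = α(u)`. -/
def canonicalMap (d : ℕ) : BV d →L[ℝ] StrongDual ℝ (SCH d) := (SCH d).subtypeL.flip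

theorem canonicalMap_apply {d : ℕ} (u : BV d) (α : SCH d) :
    canonicalMap d u α = (α : StrongDual ℝ (BV d)) u := rfl

variable {d : ℕ} [Fact (1 ≤ (d : ℝ≥0∞))]

theorem canonicalMap_toSCH_toLp (u : BV d) {f : E d → ℝ}
    (hf : MemLp f d (volume.restrict (cube d))) :
    canonicalMap d u (toSCH d (hf.toLp f)) = ∫ x, u x * f x :=
  toSCH_toLp_apply hf u

theorem variation_le_enorm_canonicalMap (u : BV d) :
    variation (u : E d → ℝ) ≤ ‖canonicalMap d u‖ₑ :=
  variation_le_enorm_of_forall_apply_divergence_eq fun _ _ => canonicalMap_toSCH_toLp u _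

theorem enorm_toL1_le_enorm_canonicalMap (u : BV d) : ‖BV.toL1 u‖ₑ ≤ ‖canonicalMap d u‖ₑ := by
  have hsign_le (x : E d) : ‖u x / |u x|‖ ≤ 1 := by
    rw [norm_div, Real.norm_eq_abs, Real.norm_eq_abs, abs_abs]
    exact div_self_le_one _
  have hmeas : Measurable (u : E d → ℝ) := (Lp.stronglyMeasurable _).measurable
  have hsign : MemLp (fun x => u x / |u x|) d (volume.restrict (cube d)) :=
    .of_bound (hmeas.div hmeas.abs).aestronglyMeasurable 1 (Eventually.of_forall hsign_le)
  have heq : canonicalMap d u (toSCH d (hsign.toLp _)) = ‖BV.toL1 u‖ := by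
    rw [canonicalMap_toSCH_toLp, u.norm_toL1_eq_integral_norm]
    refine integral_congr_ae (Eventually.of_forall fun x => ?_)
    simp only [Real.norm_eq_abs, ← mul_div_assoc, ← abs_mul_abs_self (u x), mul_self_div_self]
  calc ‖BV.toL1 u‖ₑ = ‖canonicalMap d u (toSCH d (hsign.toLp _))‖ₑ := by rw [heq, enorm_norm]
    _ ≤ ‖canonicalMap d u‖ₑ * ‖toSCH d (hsign.toLp _)‖ₑ := (canonicalMap d u).le_opENorm _
    _ ≤ ‖canonicalMap d u‖ₑ :=
        mul_le_of_le_one_right' (enorm_toSCH_toLp_le_one_of_forall_norm_le_one hsign hsign_le)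

theorem norm_le_two_mul_norm_canonicalMap (u : BV d) : ‖u‖ ≤ 2 * ‖canonicalMap d u‖ := by
  have hL1 := ENNReal.toReal_mono enorm_ne_top (enorm_toL1_le_enorm_canonicalMap u)
  have hvar := ENNReal.toReal_mono enorm_ne_top (variation_le_enorm_canonicalMap u)
  rw [toReal_enorm] at hvar
  rw [toReal_enorm, toReal_enorm] at hL1
  rw [BV.norm_def, two_mul]
  exact add_le_add hL1 hvar

theorem injective_canonicalMap : Function.Injective (canonicalMap d) :=
  (injective_iff_map_eq_zero _).2 fun u hu =>
    norm_le_zero_iff.1 (by simpa [hu] using norm_le_two_mul_norm_canonicalMap u)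

theorem surjective_canonicalMap : Function.Surjective (canonicalMap d) := by
  intro L
  obtain ⟨g, hg, hLg⟩ :=
    exists_integrable_apply_toLp_eq_integral (ENNReal.natCast_ne_top d) (L ∘L toSCH d)
  have hLind (f : E d → ℝ) (hf : MemLp f d (volume.restrict (cube d)))
      (hf_top : MemLp f ∞ (volume.restrict (cube d))) :
      L (toSCH d (hf.toLp f)) = ∫ x, (cube d).indicator g x * f x := by
    refine (hLg f hf hf_top).trans ?_
    simp_rw [← Set.indicator_mul_left, integral_indicator (measurableSet_cube d), mul_comm]
  have hvar : variation ((cube d).indicator g) ≤ ‖L‖ₑ :=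
    variation_le_enorm_of_forall_apply_divergence_eq fun v hv =>
      hLind _ _ (hv.memLp_divergence _ _)
  obtain ⟨u, hu⟩ := BV.exists_ae_eq_indicator hg (hvar.trans_lt enorm_lt_top)
  refine ⟨u, SCH.dual_ext fun f hf hf_top => ?_⟩
  rw [canonicalMap_toSCH_toLp, hLind f hf hf_top]
  exact integral_congr_ae (hu.mono fun x hx => congrArg (· * f x) hx)

/-- The canonical map as an isomorphism of Banach spaces. -/
def canonicalEquiv (d : ℕ) [Fact (1 ≤ (d : ℝ≥0∞))] : BV d ≃L[ℝ] StrongDual ℝ (SCH d) :=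
  let Υ := LinearEquiv.ofBijective (canonicalMap d).toLinearMap
    ⟨injective_canonicalMap, surjective_canonicalMap⟩
  Υ.toContinuousLinearEquivOfBounds ‖canonicalMap d‖ 2 (canonicalMap d).le_opNorm fun L =>
    (norm_le_two_mul_norm_canonicalMap (Υ.symm L)).trans_eq
      (congrArg (2 * ‖·‖) (Υ.apply_symm_apply L))

theorem completeSpace_BV (d : ℕ) [Fact (1 ≤ (d : ℝ≥0∞))] : CompleteSpace (BV d) :=
  (completeSpace_congr (e := (canonicalEquiv d).toEquiv)
    (canonicalEquiv d).isUniformEmbedding).2 inferInstance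

theorem completeSpace_SCH (d : ℕ) : CompleteSpace (SCH d) :=
  (rangeT d).isClosed_topologicalClosure.completeSpace_coe

end CanonicalMap

end StrongCharge

end

theorem mainTheorem5 (d : ℕ) (hd : 1 ≤ d) :
    -- every `T_f` is a continuous functional, with norm controlled by that of `f` in `L^d`
    (∃ C : ℝ, ∀ f : StrongCharge.Ld d, ∃ α : StrongDual ℝ (StrongCharge.BV d),
      StrongCharge.Represents f α ∧ ‖α‖ ≤ C * ‖f‖) ∧
    -- both spaces are Banach spaces and the canonical map is an isomorphism
    CompleteSpace (StrongCharge.BV d) ∧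
    CompleteSpace (StrongCharge.SCH d) ∧
    ∃ Υ : StrongCharge.BV d ≃L[ℝ] StrongDual ℝ (StrongCharge.SCH d),
      ∀ (u : StrongCharge.BV d) (α : StrongCharge.SCH d),
        Υ u α = (α : StrongDual ℝ (StrongCharge.BV d)) u := by
  have : Fact (1 ≤ (d : ENNReal)) := ⟨Nat.one_le_cast.2 hd⟩
  refine ⟨⟨‖StrongCharge.toBVDual d‖, fun f => ⟨StrongCharge.toBVDual d f,
      StrongCharge.represents_toBVDual f, (StrongCharge.toBVDual d).le_opNorm f⟩⟩,
    StrongCharge.completeSpace_BV d, StrongCharge.completeSpace_SCH d,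
    StrongCharge.canonicalEquiv d, StrongCharge.canonicalMap_apply⟩
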